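/- Let $S=\{s_1,\dots,s_r\}$ be a finite nonempty set and let $(W,S)$ be a Coxeter system, $$W=\langle S \mid (s_is_j)^{m_{ij}}=1\rangle,\qquad m_{ii}=1,\quad m_{ij}=m_{ji}\in\{2,3,\dots\}\cup\{\infty\}\ \ (i\ne j),$$ where $m_{ij}=\infty$ means that no relation is imposed on $s_is_j$. The divisibility diagram $\mathrm{Cox}_{\mathrm{div}}(W)$ has a vertex $v_i$ for each $s_i\in S$; for $i\neq j$, the vertices $v_i$ and $v_j$ are joined by an edge labelled by the least divisor of $m_{ij}$ greater than $1$ if $m_{ij}<\infty$, and are not joined (the edge is absent) if $m_{ij}=\infty$. An edge with label $3$ is called simple. A reflection is an element of $W$ conjugate to an element of $S$. If at most one edge of $\mathrm{Cox}_{\mathrm{div}}(W)$ is neither simple nor absent, then $W$ has a proper subgroup of finite index that is generated by reflections. -/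

import Mathlib

/-- The underlying graph of the divisibility diagram of a Coxeter matrix `M`: the vertices are the
indices of the generators, and two distinct vertices `i`, `j` are joined if and only if `m_ij` is
finite. (In Mathlib, `M i j = 0` encodes `m_ij = ∞`.) -/
def CoxeterMatrix.divGraph {B : Type*} (M : CoxeterMatrix B) : SimpleGraph B where
  Adj i j := i ≠ j ∧ M i j ≠ 0
  symm := ⟨fun i j h => ⟨h.1.symm, M.symmetric i j ▸ h.2⟩⟩
  loopless := ⟨fun _ h => h.1 rfl⟩

/-- The label of an edge `{i, j}` of the divisibility diagram: the least divisor of `m_ij` that is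
greater than `1`. (The value is only meaningful on edges of `M.divGraph`, where
`2 ≤ m_ij < ∞`.) -/
def CoxeterMatrix.divLabel {B : Type*} (M : CoxeterMatrix B) : Sym2 B → ℕ :=
  Sym2.lift ⟨fun i j => (M i j).minFac, fun i j => congrArg Nat.minFac (M.symmetric i j)⟩

/-- The multiple edges of the divisibility diagram: the edges whose label is not `3`, that is, the
pairs of vertices whose edge is neither simple (label `3`) nor absent. -/
def CoxeterMatrix.multipleEdges {B : Type*} (M : CoxeterMatrix B) : Set (Sym2 B) :=
  {e | e ∈ M.divGraph.edgeSet ∧ M.divLabel e ≠ 3}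

/-- A reflection subgroup of a Coxeter group: a proper subgroup generated by reflections, that is,
by conjugates of the generators. -/
def CoxeterSystem.IsReflectionSubgroup {B : Type*} {M : CoxeterMatrix B} {W : Type*} [Group W]
    (cs : CoxeterSystem M W) (V : Subgroup W) : Prop :=
  V ≠ ⊤ ∧ ∃ T : Set W, (∀ t ∈ T, cs.IsReflection t) ∧ Subgroup.closure T = V

/-!
Suppose that `W` acts on a star with centre `none` and leaves `some c`, each generator `s_i`
exchanging the centre with the leaf `some (f i)`. When `f i ≠ f j`, the product `s_i s_j` acts as a
3-cycle, so such an action exists as soon as `3 ∣ m_ij` for all these pairs. Let `V` be generated by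
the reflections fixing the centre; it is proper because generators move the centre. Let `N` be
generated by the products `s_i s_j` with `f i = f j`; it acts trivially. If `f i ≠ f j` and `r ∈ N`,
the conjugate of `s_i` by `s_j r` fixes the centre, that is, `s_i` fixes the coset `s_j r V`.
Hence the cosets `r V` and `s_j r V` with `r ∈ N` are permuted by the generators and exhaust
`W ⧸ V`, so `V` has finite index when `N` is finite. If there is a single multiple edge,
let `f` identify just its two ends; then `N` is a finite cyclic group. If there is none, let `f` be
injective; then `N` is trivial.
-/

open Equiv (Perm swap)
open scoped Pointwise

theorem swap_mul_swap_pow_three {α : Type*} [DecidableEq α] {x y z : α} (hxy : x ≠ y)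
    (hxz : x ≠ z) (hyz : y ≠ z) : (swap x y * swap x z) ^ 3 = 1 := by
  have hy : swap x y * swap x z * swap x y = swap y z := by
    simpa only [Equiv.swap_comm] using Equiv.swap_mul_swap_mul_swap hxz.symm hyz.symm
  have hz : swap x z * swap x y * swap x z = swap y z := by
    simpa only [Equiv.swap_comm] using Equiv.swap_mul_swap_mul_swap hxy.symm hyz
  calc (swap x y * swap x z) ^ 3
      = (swap x y * swap x z * swap x y) * (swap x z * swap x y * swap x z) := by
        simp only [pow_succ, pow_zero, one_mul, mul_assoc]
    _ = 1 := by rw [hy, hz, Equiv.swap_mul_self]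

theorem update_id_eq_update_id_iff {α : Type*} [DecidableEq α] {a b i j : α} :
    Function.update id b a i = Function.update id b a j ↔ i = j ∨ s(i, j) = s(a, b) := by
  simp only [Function.update_apply, id_eq, Sym2.eq_iff]
  grind

section CoxeterSystem

variable {B C W X : Type*} {M : CoxeterMatrix B} [Group W] (cs : CoxeterSystem M W)

theorem finiteIndex_of_simple_smul_mem {V : Subgroup W} {Q : Set (W ⧸ V)} (hQ : Q.Finite)
    (one_mem : ((1 : W) : W ⧸ V) ∈ Q) (smul_mem : ∀ i, ∀ q ∈ Q, cs.simple i • q ∈ Q) :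
    V.FiniteIndex := by
  have coe_mem (w : W) : (w : W ⧸ V) ∈ Q := by
    induction w using cs.simple_induction_left with
    | one => exact one_mem
    | mul_simple_left w i ih => exact smul_mem i _ ih
  have : Finite (W ⧸ V) :=
    Set.finite_univ_iff.1 (hQ.subset fun q _ => QuotientGroup.induction_on q coe_mem)
  exact Subgroup.finiteIndex_of_finite_quotient

/-- The subgroup generated by the reflections that fix the point `x` under the action `φ`. It may
be smaller than the stabilizer of `x`. -/
def reflectionStabilizer (φ : W →* Perm X) (x : X) : Subgroup W :=
  Subgroup.closure {t | cs.IsReflection t ∧ φ t x = x}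

theorem isReflectionSubgroup_reflectionStabilizer {φ : W →* Perm X} {x : X} {w : W}
    (hw : φ w x ≠ x) : cs.IsReflectionSubgroup (reflectionStabilizer cs φ x) := by
  refine ⟨fun htop => hw ?_, _, fun t ht => ht.1, rfl⟩
  have hle : reflectionStabilizer cs φ x ≤ (MulAction.stabilizer (Perm X) x).comap φ :=
    (Subgroup.closure_le _).2 fun t ht => ht.2
  exact hle (htop ▸ Subgroup.mem_top w)

theorem simple_smul_coe_eq {φ : W →* Perm X} {x : X} {i : B} {w : W}
    (hi : φ (cs.simple i) (φ w x) = φ w x) :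
    cs.simple i • (w : W ⧸ reflectionStabilizer cs φ x) = w := by
  have hconj : w⁻¹ * cs.simple i * w ∈ reflectionStabilizer cs φ x :=
    Subgroup.subset_closure ⟨⟨w⁻¹, i, by rw [inv_inv]⟩, by
      simp only [map_mul, map_inv, Perm.mul_apply, hi, Perm.inv_eq_iff_eq]⟩
  refine (QuotientGroup.eq.2 ?_).symm
  simpa only [smul_eq_mul, mul_assoc] using hconj

/-- The subgroup generated by the products of two generators whose indices lie in the same fibre
of `f`. -/
def fiberSubgroup (f : B → C) : Subgroup W :=
  Subgroup.closure {w | ∃ i j, f i = f j ∧ cs.simple i * cs.simple j = w}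

theorem finite_fiberSubgroup_update [DecidableEq B] {a b : B} (hab : M a b ≠ 0) :
    Finite (fiberSubgroup cs (Function.update id b a)) := by
  have hle : fiberSubgroup cs (Function.update id b a) ≤
      Subgroup.zpowers (cs.simple a * cs.simple b) := by
    refine (Subgroup.closure_le _).2 ?_
    rintro _ ⟨i, j, hij, rfl⟩
    obtain rfl | hij := update_id_eq_update_id_iff.1 hij
    · simp only [cs.simple_mul_simple_self, SetLike.mem_coe, one_mem]
    obtain ⟨rfl, rfl⟩ | ⟨rfl, rfl⟩ := Sym2.eq_iff.1 hij
    · exact Subgroup.mem_zpowers _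
    · simpa only [mul_inv_rev, cs.inv_simple, SetLike.mem_coe] using
        inv_mem (Subgroup.mem_zpowers (cs.simple j * cs.simple i))
  have : Finite (Subgroup.zpowers (cs.simple a * cs.simple b)) :=
    finite_zpowers.2 <| isOfFinOrder_iff_pow_eq_one.2
      ⟨M a b, Nat.pos_of_ne_zero hab, cs.simple_mul_simple_pow a b⟩
  exact Finite.of_injective _ (Subgroup.inclusion_injective hle)

section StarAction

variable {f : B → C} [DecidableEq C]

theorem exists_starAction (hf : ∀ i j, f i ≠ f j → 3 ∣ M i j) :
    ∃ φ : W →* Perm (Option C), ∀ i, φ (cs.simple i) = swap none (some (f i)) := by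
  have hlift : M.IsLiftable fun i => swap none (some (f i)) := by
    intro i j
    beta_reduce
    by_cases hij : f i = f j
    · rw [hij, Equiv.swap_mul_self, one_pow]
    · obtain ⟨k, hk⟩ := hf i j hij
      rw [hk, pow_mul, swap_mul_swap_pow_three (Option.some_ne_none _).symm
        (Option.some_ne_none _).symm (mt (Option.some.inj ·) hij), one_pow]
  exact ⟨cs.lift ⟨_, hlift⟩, cs.lift_apply_simple hlift⟩

variable {φ : W →* Perm (Option C)}

theorem fiberSubgroup_le_ker (hφ : ∀ i, φ (cs.simple i) = swap none (some (f i))) :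
    fiberSubgroup cs f ≤ φ.ker := by
  refine (Subgroup.closure_le _).2 ?_
  rintro _ ⟨i, j, hij, rfl⟩
  rw [SetLike.mem_coe, MonoidHom.mem_ker, map_mul, hφ, hφ, hij, Equiv.swap_mul_self]

theorem finiteIndex_reflectionStabilizer_none [Finite B] [Finite (fiberSubgroup cs f)]
    (hφ : ∀ i, φ (cs.simple i) = swap none (some (f i))) :
    (reflectionStabilizer cs φ none).FiniteIndex := by
  let N : Set (W ⧸ reflectionStabilizer cs φ none) := (↑) '' (fiberSubgroup cs f : Set W)
  have hN : N.Finite := (Set.toFinite (fiberSubgroup cs f : Set W)).image _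
  have smul_smul_mem (i j : B) : ∀ q ∈ N, cs.simple i • cs.simple j • q ∈
      N ∪ ⋃ k, cs.simple k • N := by
    rintro _ ⟨r, hr, rfl⟩
    by_cases hij : f i = f j
    · refine .inl ⟨cs.simple i * cs.simple j * r, ?_, ?_⟩
      · exact mul_mem (Subgroup.subset_closure ⟨i, j, hij, rfl⟩) hr
      · rw [smul_smul]; rfl
    · have hfix : φ (cs.simple i) (φ (cs.simple j * r) none) = φ (cs.simple j * r) none := by
        rw [map_mul, MonoidHom.mem_ker.1 (fiberSubgroup_le_ker cs hφ hr), mul_one, hφ, hφ,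
          Equiv.swap_apply_left]
        exact Equiv.swap_apply_of_ne_of_ne (Option.some_ne_none _)
          (mt (Option.some.inj ·) (Ne.symm hij))
      exact .inr (Set.mem_iUnion_of_mem j ⟨r, ⟨r, hr, rfl⟩, (simple_smul_coe_eq cs hfix).symm⟩)
  refine finiteIndex_of_simple_smul_mem cs
    (hN.union (Set.finite_iUnion fun k => hN.smul_set (a := cs.simple k)))
    (.inl ⟨1, one_mem _, rfl⟩) ?_
  rintro i q (hq | hq)
  · exact .inr (Set.mem_iUnion_of_mem i (Set.smul_mem_smul_set hq))
  · obtain ⟨j, p, hp, rfl⟩ := Set.mem_iUnion.1 hq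
    exact smul_smul_mem i j p hp

end StarAction

theorem exists_isReflectionSubgroup_finiteIndex_of_finite_fiberSubgroup [Finite B] [Nonempty B]
    (f : B → C) [Finite (fiberSubgroup cs f)] (hf : ∀ i j, f i ≠ f j → 3 ∣ M i j) :
    ∃ V : Subgroup W, cs.IsReflectionSubgroup V ∧ V.FiniteIndex := by
  classical
  obtain ⟨φ, hφ⟩ := exists_starAction cs hf
  obtain ⟨i⟩ := ‹Nonempty B›
  have hmove : φ (cs.simple i) none ≠ none := by
    rw [hφ, Equiv.swap_apply_left]
    exact Option.some_ne_none _
  exact ⟨_, isReflectionSubgroup_reflectionStabilizer cs hmove,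
    finiteIndex_reflectionStabilizer_none cs hφ⟩

/-- The edges of the divisibility diagram whose order `m_ij` is not divisible by `3`. Since
`m_ij = ∞` is encoded as `M i j = 0`, absent edges are excluded automatically. -/
def nonTripleEdges (M : CoxeterMatrix B) : Set (Sym2 B) :=
  {e | ∃ i j, i ≠ j ∧ ¬ 3 ∣ M i j ∧ s(i, j) = e}

theorem nonTripleEdges_subset_multipleEdges (M : CoxeterMatrix B) :
    nonTripleEdges M ⊆ M.multipleEdges := by
  rintro _ ⟨i, j, hij, h3, rfl⟩
  have hadj : M.divGraph.Adj i j := ⟨hij, fun h0 => h3 (h0 ▸ dvd_zero 3)⟩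
  exact ⟨hadj, fun (hlabel : (M i j).minFac = 3) => h3 (hlabel ▸ Nat.minFac_dvd _)⟩

theorem exists_nonTripleEdges_subset_singleton [Nonempty B]
    (h : (nonTripleEdges M).encard ≤ 1) :
    ∃ a b, M a b ≠ 0 ∧ nonTripleEdges M ⊆ {s(a, b)} := by
  obtain hempty | ⟨_, a, b, hab, h3, rfl⟩ := (nonTripleEdges M).eq_empty_or_nonempty
  · obtain ⟨a⟩ := ‹Nonempty B›
    exact ⟨a, a, M.diagonal a ▸ one_ne_zero, hempty ▸ Set.empty_subset _⟩
  · exact ⟨a, b, fun h0 => h3 (h0 ▸ dvd_zero 3),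
      fun _ he => Set.encard_le_one_iff.1 h _ _ he ⟨a, b, hab, h3, rfl⟩⟩

end CoxeterSystem

theorem lemma4p2_general {B : Type*} [Finite B] [Nonempty B] {M : CoxeterMatrix B}
    {W : Type*} [Group W] (cs : CoxeterSystem M W) (h : (nonTripleEdges M).encard ≤ 1) :
    ∃ V : Subgroup W, cs.IsReflectionSubgroup V ∧ V.FiniteIndex := by
  classical
  obtain ⟨a, b, hab, hsub⟩ := exists_nonTripleEdges_subset_singleton h
  have := finite_fiberSubgroup_update cs hab
  refine exists_isReflectionSubgroup_finiteIndex_of_finite_fiberSubgroup cs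
    (Function.update id b a) fun i j hij => ?_
  rw [Ne, update_id_eq_update_id_iff, not_or] at hij
  by_contra h3
  exact hij.2 (hsub ⟨i, j, hij.1, h3, rfl⟩)

theorem lemma4p2 {B : Type*} [Finite B] [Nonempty B] {M : CoxeterMatrix B}
    {W : Type*} [Group W] (cs : CoxeterSystem M W)
    (h : M.multipleEdges.encard ≤ 1) :
    ∃ V : Subgroup W, cs.IsReflectionSubgroup V ∧ V.FiniteIndex :=
  lemma4p2_general cs ((Set.encard_le_encard (nonTripleEdges_subset_multipleEdges M)).trans h)
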